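/- For complex numbers $g_2,g_3$, the Weierstrass function $\wp(\,\cdot\,;g_2,g_3)$ with invariants $g_2,g_3$ is the Weierstrass function $\wp_L(z)=\frac1{z^2}+\sum_{0\ne l\in L}\left(\frac1{(z-l)^2}-\frac1{l^2}\right)$ of a lattice $L\subset\mathbb{C}$ for which $60\sum_{0\neq l\in L} l^{-4}=g_2$ and $140\sum_{0\neq l\in L} l^{-6}=g_3$. Let $0<\kappa<1$ and let $\lambda=\sqrt{1-\kappa^2}$. Then each of the Weierstrass functions $$P_\kappa=\wp\bigl(\,\cdot\,;\,48(1+8\kappa^2),\,64(1-20\kappa^2-8\kappa^4)\bigr)$$ and $$p_\lambda=\wp\bigl(\,\cdot\,;\,\tfrac{4}{27}(8\kappa^2+1),\,\tfrac{8}{729}(8\kappa^4+20\kappa^2-1)\bigr)$$ exists and is uniquely determined by its invariants, and $$P_\kappa(z)=-18\,p_\lambda(3\sqrt2\,\mathrm{i}\,z)\qquad(z\in\mathbb{C}),$$ where at a pole each function is assigned the value $0$; in particular this is an identity of meromorphic functions on $\mathbb{C}$. -/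

import Mathlib

/-- `IsWeierstrassP g₂ g₃ f` says that `f` is the Weierstrass function `℘(·; g₂, g₃)` with
invariants `g₂, g₃`: there is a period lattice whose invariants `60 ∑' l⁻⁴` and `140 ∑' l⁻⁶`
are `g₂` and `g₃`, and `f` is the Weierstrass `℘` function of that lattice. As everywhere in
Mathlib, the value assigned to `℘` at its poles (the lattice points) is `0`. -/
def IsWeierstrassP (g₂ g₃ : ℂ) (f : ℂ → ℂ) : Prop :=
  ∃ L : PeriodPair, L.g₂ = g₂ ∧ L.g₃ = g₃ ∧ f = L.weierstrassP

/-- `IsShenP κ P` says that `P` is the function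
`P_κ = ℘(·; 48 (1 + 8 κ²), 64 (1 - 20 κ² - 8 κ⁴))`. -/
def IsShenP (κ : ℝ) (P : ℂ → ℂ) : Prop :=
  IsWeierstrassP (48 * (1 + 8 * (κ : ℂ) ^ 2)) (64 * (1 - 20 * (κ : ℂ) ^ 2 - 8 * (κ : ℂ) ^ 4)) P

/-- `IsShenSmallP κ p` says that `p` is the function
`p_lam = ℘(·; (4/27) (8 κ² + 1), (8/729) (8 κ⁴ + 20 κ² - 1))`, where `lam = √(1 - κ²)` is the
modulus complementary to `κ`. -/
def IsShenSmallP (κ : ℝ) (p : ℂ → ℂ) : Prop :=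
  IsWeierstrassP (4 / 27 * (8 * (κ : ℂ) ^ 2 + 1))
    (8 / 729 * (8 * (κ : ℂ) ^ 4 + 20 * (κ : ℂ) ^ 2 - 1)) p

open Filter Topology

/-! Since `(3√2 i)² = -18`, homogeneity of `℘` turns `p` into a Weierstrass function with the
invariants of `P`; the identity then follows from uniqueness (`weierstrassP_eq_of_invariants`), and
existence is needed only for `p`.

Uniqueness: for equal invariants, the difference `u` of two such functions satisfies `u'' = 6(℘_L +
℘_M)u`, whose indicial equation `n(n-1) = 12` at `0` allows only order 4, while equal invariants
force order at least 5. So `u = 0` near `0`, and the lattices are recovered as pole sets.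

Existence (`exists_invariants_eq`): on the imaginary axis `E₆/E₄^(3/2)` is real and runs from `-1`
to `1`, hence realises every real pair `(g₂, g₃)` with `g₂ > 0` and `g₂³ > 27g₃²` up to scaling. -/

/-- An analytic solution of `z² u'' = a u` with `a 0 = 12` that vanishes to order at least five at
the origin vanishes identically near the origin. -/
lemma AnalyticAt.eventually_eq_zero_of_sq_mul_deriv_deriv {u a : ℂ → ℂ} (hu : AnalyticAt ℂ u 0)
    (ha : ContinuousAt a 0) (ha0 : a 0 = 12) (hord : 5 ≤ analyticOrderAt u 0)
    (hode : ∀ᶠ z in 𝓝[≠] (0 : ℂ), z ^ 2 * deriv (deriv u) z = a z * u z) :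
    ∀ᶠ z in 𝓝 (0 : ℂ), u z = 0 := by
  rw [← analyticOrderAt_eq_top]
  by_contra htop
  obtain ⟨v, hv, hv0, huv⟩ := hu.analyticOrderAt_ne_top.mp htop
  have hn : 5 ≤ analyticOrderNatAt u 0 := by
    rw [← Nat.cast_analyticOrderNatAt htop] at hord
    exact_mod_cast hord
  obtain ⟨m, hm⟩ : ∃ m, analyticOrderNatAt u 0 = m + 2 := ⟨_, (Nat.sub_add_cancel (by omega)).symm⟩
  simp only [hm, sub_zero, smul_eq_mul] at huv hn
  have hd1 : deriv u =ᶠ[𝓝 0] fun z ↦ (m + 2) * z ^ (m + 1) * v z + z ^ (m + 2) * deriv v z := by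
    refine huv.deriv.trans ?_
    filter_upwards [hv.eventually_analyticAt] with z hz
    have := (hasDerivAt_pow (m + 2) z).mul hz.differentiableAt.hasDerivAt
    simpa using! this.deriv
  have hd2 : deriv (deriv u) =ᶠ[𝓝 0] fun z ↦ (m + 2) * (m + 1) * z ^ m * v z +
      2 * (m + 2) * z ^ (m + 1) * deriv v z + z ^ (m + 2) * deriv (deriv v) z := by
    refine hd1.deriv.trans ?_
    filter_upwards [hv.eventually_analyticAt] with z hz
    have h1 := (((hasDerivAt_pow (m + 1) z).const_mul (m + 2 : ℂ)).mul
      hz.differentiableAt.hasDerivAt).add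
      ((hasDerivAt_pow (m + 2) z).mul hz.deriv.differentiableAt.hasDerivAt)
    refine (HasDerivAt.deriv h1).trans ?_
    push_cast
    ring
  have hlim : ∀ᶠ z in 𝓝[≠] (0 : ℂ), (m + 2) * (m + 1) * v z + 2 * (m + 2) * z * deriv v z +
      z ^ 2 * deriv (deriv v) z - a z * v z = 0 := by
    filter_upwards [hode, hd2.filter_mono nhdsWithin_le_nhds, huv.filter_mono nhdsWithin_le_nhds,
      self_mem_nhdsWithin] with z h1 h2 h3 hz
    rw [h2, h3] at h1
    have hz' : z ^ (m + 2) ≠ 0 := pow_ne_zero _ hz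
    apply mul_left_cancel₀ hz'
    linear_combination h1
  have hc : ContinuousAt (fun z ↦ (m + 2) * (m + 1) * v z + 2 * (m + 2) * z * deriv v z +
      z ^ 2 * deriv (deriv v) z - a z * v z) 0 := by
    have h0 := hv.continuousAt
    have h1 := hv.deriv.continuousAt
    have h2 := hv.deriv.deriv.continuousAt
    fun_prop
  -- Letting `z → 0` yields the indicial equation for the order `m + 2`.
  have h0 := tendsto_nhds_unique (hc.tendsto.mono_left nhdsWithin_le_nhds)
    (tendsto_const_nhds.congr' (hlim.mono fun z hz ↦ hz.symm))
  have h12 : ((m : ℂ) + 2) * (m + 1) = 12 := by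
    apply mul_right_cancel₀ hv0
    rw [ha0] at h0
    linear_combination h0
  have h12' : (m + 2) * (m + 1) = 12 := by exact_mod_cast h12
  nlinarith

/-! ### Homogeneity, and uniqueness from the invariants -/

namespace PeriodPair

/-- The period pair scaled by a nonzero complex number. -/
def scale (L : PeriodPair) (c : ℂ) (hc : c ≠ 0) : PeriodPair where
  ω₁ := c * L.ω₁
  ω₂ := c * L.ω₂
  indep := by
    rw [LinearIndependent.pair_iff]
    intro s t h
    refine LinearIndependent.pair_iff.mp L.indep s t ?_
    apply mul_left_cancel₀ hc
    simp only [Complex.real_smul] at h ⊢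
    linear_combination h

/-- Scaling as an equivalence of the period lattices. -/
noncomputable def latticeEquivScale (L : PeriodPair) (c : ℂ) (hc : c ≠ 0) :
    L.lattice ≃ (L.scale c hc).lattice where
  toFun l := ⟨c * l, by
    obtain ⟨m, n, h⟩ := mem_lattice.mp l.2
    exact mem_lattice.mpr ⟨m, n, by rw [← h]; simp only [scale]; ring⟩⟩
  invFun l := ⟨c⁻¹ * l, by
    obtain ⟨m, n, h⟩ := mem_lattice.mp l.2
    refine mem_lattice.mpr ⟨m, n, ?_⟩
    rw [← h]
    simp only [scale]
    field_simp⟩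
  left_inv l := by ext; simp [hc]
  right_inv l := by ext; simp [hc]

@[simp]
lemma coe_latticeEquivScale (L : PeriodPair) (c : ℂ) (hc : c ≠ 0) (l : L.lattice) :
    (L.latticeEquivScale c hc l : ℂ) = c * l := rfl

lemma weierstrassP_scale (L : PeriodPair) (c : ℂ) (hc : c ≠ 0) (z : ℂ) :
    (L.scale c hc).weierstrassP (c * z) = (c ^ 2)⁻¹ * L.weierstrassP z := by
  rw [weierstrassP, weierstrassP, ← (L.latticeEquivScale c hc).tsum_eq, ← tsum_mul_left]
  refine tsum_congr fun l ↦ ?_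
  rw [coe_latticeEquivScale, ← mul_sub, mul_pow, mul_pow]
  simp only [one_div, mul_inv]
  ring

lemma G_scale (L : PeriodPair) (c : ℂ) (hc : c ≠ 0) (n : ℕ) :
    (L.scale c hc).G n = (c ^ n)⁻¹ * L.G n := by
  rw [G, G, ← (L.latticeEquivScale c hc).tsum_eq, ← tsum_mul_left]
  refine tsum_congr fun l ↦ ?_
  rw [coe_latticeEquivScale, mul_pow, mul_inv]

lemma g₂_scale (L : PeriodPair) (c : ℂ) (hc : c ≠ 0) :
    (L.scale c hc).g₂ = (c ^ 4)⁻¹ * L.g₂ := by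
  rw [g₂, g₂, G_scale]
  ring

lemma g₃_scale (L : PeriodPair) (c : ℂ) (hc : c ≠ 0) :
    (L.scale c hc).g₃ = (c ^ 6)⁻¹ * L.g₃ := by
  rw [g₃, g₃, G_scale]
  ring

lemma weierstrassP_eq_of_lattice_eq {L M : PeriodPair} (h : L.lattice = M.lattice) :
    L.weierstrassP = M.weierstrassP := by
  funext z
  simp only [weierstrassP]
  rw [h]

lemma eventually_notMem_lattice (L : PeriodPair) (x : ℂ) : ∀ᶠ z in 𝓝[≠] x, z ∉ L.lattice := by
  filter_upwards [self_mem_nhdsWithin, mem_nhdsWithin_of_mem_nhds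
    (L.compl_lattice_sdiff_singleton_mem_nhds x)] with z hz hz'
  simp_all

/-- Differentiate the cubic equation for `℘'²` and cancel `2℘'`, which is why `℘' ≠ 0` is assumed.
-/
lemma deriv_derivWeierstrassP (L : PeriodPair) {z : ℂ} (hz : z ∉ L.lattice)
    (hz' : L.derivWeierstrassP z ≠ 0) :
    deriv L.derivWeierstrassP z = 6 * L.weierstrassP z ^ 2 - L.g₂ / 2 := by
  have hmem : ∀ᶠ w in 𝓝 z, w ∉ L.lattice := L.isClosed_lattice.isOpen_compl.mem_nhds hz
  have hP : HasDerivAt L.weierstrassP (L.derivWeierstrassP z) z := by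
    have := (L.analyticOnNhd_weierstrassP z hz).differentiableAt.hasDerivAt
    rwa [deriv_weierstrassP] at this
  have hP' := (L.analyticOnNhd_derivWeierstrassP z hz).differentiableAt.hasDerivAt
  have h1 := hP'.fun_pow 2
  have h2 := ((((hP.fun_pow 3).const_mul 4).sub (hP.const_mul L.g₂)).sub_const L.g₃)
  have h3 := h1.unique (h2.congr_of_eventuallyEq (hmem.mono fun w hw ↦ L.derivWeierstrassP_sq w hw))
  apply mul_left_cancel₀ hz'
  norm_num at h3
  linear_combination h3 / 2

/-- `z³℘'(z)` tends to `-2` at the origin. -/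
lemma eventually_derivWeierstrassP_ne_zero (L : PeriodPair) :
    ∀ᶠ z in 𝓝[≠] (0 : ℂ), L.derivWeierstrassP z ≠ 0 := by
  have hc : ContinuousAt (fun z ↦ z ^ 3 * L.derivWeierstrassPExcept 0 z - 2) 0 := by
    have := (L.analyticAt_derivWeierstrassPExcept 0).continuousAt
    fun_prop
  have hne := hc.eventually_ne (y := 0) (by simp)
  filter_upwards [hne.filter_mono nhdsWithin_le_nhds, self_mem_nhdsWithin] with z h1 hz h0
  have := L.derivWeierstrassPExcept_def 0 z
  simp only [ZeroMemClass.coe_zero, sub_zero, h0, zero_add] at this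
  have hz' : z ≠ 0 := hz
  rw [this] at h1
  apply h1
  field_simp
  ring

lemma weierstrassPExcept_zero_eq (L : PeriodPair) (z : ℂ) :
    L.weierstrassPExcept 0 z = L.weierstrassP z - 1 / z ^ 2 := by
  have := L.weierstrassPExcept_def 0 z
  simp only [ZeroMemClass.coe_zero, sub_zero] at this
  rw [this]
  simp [sub_eq_add_neg]

/-- The Taylor coefficients up to degree 4 involve only `G 3`, `G 4`, `G 5`, `G 6`; the odd ones
vanish and the even ones are fixed by the invariants. -/
lemma five_le_analyticOrderAt_sub (L M : PeriodPair) (h₂ : L.g₂ = M.g₂) (h₃ : L.g₃ = M.g₃) :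
    5 ≤ analyticOrderAt (fun z ↦ L.weierstrassPExcept 0 z - M.weierstrassPExcept 0 z) 0 := by
  have hL := L.analyticAt_weierstrassPExcept 0
  have hM := M.analyticAt_weierstrassPExcept 0
  have h4 : L.G 4 = M.G 4 := by simpa [g₂] using h₂
  have h6 : L.G 6 = M.G 6 := by simpa [g₃] using h₃
  refine (natCast_le_analyticOrderAt_iff_iteratedDeriv_eq_zero (n := 5) (hL.fun_sub hM)).mpr ?_
  intro i hi
  rw [iteratedDeriv_fun_sub hL.contDiffAt hM.contDiffAt, iteratedDeriv_weierstrassPExcept_self,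
    iteratedDeriv_weierstrassPExcept_self]
  interval_cases i
  · simp
  · simp [G_eq_zero_of_odd _ 3 (by decide)]
  · simp [h4]
  · simp [G_eq_zero_of_odd _ 5 (by decide)]
  · simp [h6]

lemma eventuallyEq_weierstrassP_of_invariants (L M : PeriodPair) (h₂ : L.g₂ = M.g₂)
    (h₃ : L.g₃ = M.g₃) : L.weierstrassP =ᶠ[𝓝 0] M.weierstrassP := by
  have hL := L.analyticAt_weierstrassPExcept 0
  have hM := M.analyticAt_weierstrassPExcept 0
  have hu : (fun z ↦ L.weierstrassPExcept 0 z - M.weierstrassPExcept 0 z) =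
      fun z ↦ L.weierstrassP z - M.weierstrassP z := by
    funext z
    rw [weierstrassPExcept_zero_eq, weierstrassPExcept_zero_eq]
    ring
  -- Here `a` is `6z²(℘_L + ℘_M)`, written with the regular parts so that it is continuous at `0`
  -- with value 12.
  have hkey := (hL.fun_sub hM).eventually_eq_zero_of_sq_mul_deriv_deriv
    (a := fun z ↦ 6 * ((z ^ 2 * L.weierstrassPExcept 0 z + 1) +
      (z ^ 2 * M.weierstrassPExcept 0 z + 1)))
    (by have := hL.continuousAt; have := hM.continuousAt; fun_prop) (by norm_num)
    (five_le_analyticOrderAt_sub L M h₂ h₃) ?_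
  · filter_upwards [hkey] with z hz
    have := congrFun hu z
    simp only [hz] at this
    exact sub_eq_zero.mp this.symm
  · rw [hu]
    filter_upwards [L.eventually_notMem_lattice 0, M.eventually_notMem_lattice 0,
      L.eventually_derivWeierstrassP_ne_zero, M.eventually_derivWeierstrassP_ne_zero,
      self_mem_nhdsWithin] with z hzL hzM hL' hM' hz
    have hz : z ≠ 0 := hz
    have hd : deriv (fun z ↦ L.weierstrassP z - M.weierstrassP z) =ᶠ[𝓝 z]
        fun z ↦ L.derivWeierstrassP z - M.derivWeierstrassP z := by
      filter_upwards [L.isClosed_lattice.isOpen_compl.mem_nhds hzL,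
        M.isClosed_lattice.isOpen_compl.mem_nhds hzM] with w hwL hwM
      rw [deriv_fun_sub (L.analyticOnNhd_weierstrassP w hwL).differentiableAt
        (M.analyticOnNhd_weierstrassP w hwM).differentiableAt, deriv_weierstrassP,
        deriv_weierstrassP]
    rw [hd.deriv_eq, deriv_fun_sub (L.analyticOnNhd_derivWeierstrassP z hzL).differentiableAt
        (M.analyticOnNhd_derivWeierstrassP z hzM).differentiableAt,
        L.deriv_derivWeierstrassP hzL hL', M.deriv_derivWeierstrassP hzM hM', h₂]
    simp only [weierstrassPExcept_zero_eq]
    field_simp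
    ring

/-- The complement of a countable set in `ℂ` is connected, so equality spreads off both lattices; a
point of `L` outside `M` would be a double pole of one function and a regular point of the other. -/
lemma lattice_le_of_eventuallyEq {L M : PeriodPair} (h : L.weierstrassP =ᶠ[𝓝 0] M.weierstrassP) :
    L.lattice ≤ M.lattice := by
  have hopen : IsOpen ((L.lattice : Set ℂ) ∪ M.lattice)ᶜ :=
    (L.isClosed_lattice.union M.isClosed_lattice).isOpen_compl
  have hconn : IsPreconnected ((L.lattice : Set ℂ) ∪ M.lattice)ᶜ := by
    have hcount : ((L.lattice : Set ℂ) ∪ M.lattice).Countable :=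
      Set.Countable.union (countable_of_Lindelof_of_discrete (X := L.lattice))
        (countable_of_Lindelof_of_discrete (X := M.lattice))
    exact (hcount.isConnected_compl_of_one_lt_rank (by simp)).isPreconnected
  obtain ⟨w, hwL, hwM, hw⟩ := ((L.eventually_notMem_lattice 0).and
    ((M.eventually_notMem_lattice 0).and
      (h.eventually_nhds.filter_mono nhdsWithin_le_nhds))).exists
  have heq : Set.EqOn L.weierstrassP M.weierstrassP ((L.lattice : Set ℂ) ∪ M.lattice)ᶜ :=
    AnalyticOnNhd.eqOn_of_preconnected_of_eventuallyEq
      (L.analyticOnNhd_weierstrassP.mono (Set.compl_subset_compl.mpr Set.subset_union_left))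
      (M.analyticOnNhd_weierstrassP.mono (Set.compl_subset_compl.mpr Set.subset_union_right))
      hconn (z₀ := w) (by simp [hwL, hwM]) hw
  intro l hl
  by_contra hlM
  have hnear : L.weierstrassP =ᶠ[𝓝[≠] l] M.weierstrassP := by
    filter_upwards [L.eventually_notMem_lattice l, M.eventually_notMem_lattice l] with z h1 h2
    exact heq (by simp [h1, h2])
  have h1 := L.order_weierstrassP l hl
  have h2 := (M.analyticOnNhd_weierstrassP l hlM).meromorphicOrderAt_nonneg
  rw [← meromorphicOrderAt_congr hnear, h1] at h2
  exact absurd h2 (by decide)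

/-- The Weierstrass function is determined by its invariants. -/
theorem weierstrassP_eq_of_invariants {L M : PeriodPair} (h₂ : L.g₂ = M.g₂) (h₃ : L.g₃ = M.g₃) :
    L.weierstrassP = M.weierstrassP := by
  have h := eventuallyEq_weierstrassP_of_invariants L M h₂ h₃
  exact weierstrassP_eq_of_lattice_eq
    (le_antisymm (lattice_le_of_eventuallyEq h) (lattice_le_of_eventuallyEq h.symm))

end PeriodPair

/-! ### Invariants of the lattices `ℤτ + ℤ` -/

namespace PeriodPair

/-- The period pair `(τ, 1)` of a point `τ` of the upper half plane. -/
def ofUpperHalfPlane (τ : UpperHalfPlane) : PeriodPair where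
  ω₁ := τ
  ω₂ := 1
  indep := by
    rw [LinearIndependent.pair_iff]
    intro s t h
    have him := congrArg Complex.im h
    have hre := congrArg Complex.re h
    simp at him hre
    have hs : s = 0 := him.resolve_right τ.im_ne_zero
    exact ⟨hs, by simpa [hs] using hre⟩

open EisensteinSeries in
lemma G_ofUpperHalfPlane (τ : UpperHalfPlane) {k : ℕ} (hk : 3 ≤ k) :
    (ofUpperHalfPlane τ).G k = 2 * riemannZeta k * ModularForm.E hk τ := by
  have h1 : (ofUpperHalfPlane τ).G k = ∑' v : Fin 2 → ℤ, eisSummand k v τ := by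
    rw [G, ← (ofUpperHalfPlane τ).latticeEquivProd.symm.toEquiv.tsum_eq,
      ← (finTwoArrowEquiv ℤ).tsum_eq]
    refine tsum_congr fun v ↦ ?_
    change (((ofUpperHalfPlane τ).latticeEquivProd.symm (v 0, v 1) : ℂ) ^ k)⁻¹ = _
    rw [latticeEquiv_symm_apply]
    simp [eisSummand, ofUpperHalfPlane]
  have h2 : ModularForm.E hk τ = (1 / 2 : ℂ) * eisensteinSeries (N := 1) 0 k τ := rfl
  rw [h1, tsum_eisSummand_eq_riemannZeta_mul_eisensteinSeries hk, h2]
  ring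

lemma _root_.riemannZeta_six : riemannZeta 6 = Real.pi ^ 6 / 945 := by
  have h := riemannZeta_two_mul_nat (k := 3) (by norm_num)
  rw [show bernoulli (2 * 3) = 1 / 42 by decide +kernel] at h
  norm_num [Nat.factorial] at h
  rw [h]
  ring

lemma g₂_ofUpperHalfPlane (τ : UpperHalfPlane) :
    (ofUpperHalfPlane τ).g₂ = 4 * Real.pi ^ 4 / 3 * ModularForm.E₄ τ := by
  rw [g₂, G_ofUpperHalfPlane τ (by norm_num : 3 ≤ 4)]
  push_cast
  rw [riemannZeta_four]
  ring

lemma g₃_ofUpperHalfPlane (τ : UpperHalfPlane) :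
    (ofUpperHalfPlane τ).g₃ = 8 * Real.pi ^ 6 / 27 * ModularForm.E₆ τ := by
  rw [g₃, G_ofUpperHalfPlane τ (by norm_num : 3 ≤ 6)]
  push_cast
  rw [riemannZeta_six]
  ring

end PeriodPair

/-! ### Eisenstein series on the imaginary axis -/

namespace EisensteinSeries

open UpperHalfPlane ModularForm
open scoped ArithmeticFunction.sigma

/-- The normalised Eisenstein series of weight `k` on the positive imaginary axis. -/
noncomputable def imagAxis {k : ℕ} (hk : 3 ≤ k) (t : ℝ) : ℝ :=
  (E hk (ofComplex (Complex.I * t))).re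

lemma coe_ofComplex_I_mul {t : ℝ} (ht : 0 < t) :
    ((ofComplex (Complex.I * t) : ℍ) : ℂ) = Complex.I * t := by
  rw [ofComplex_apply_of_im_pos (by simpa using ht)]

lemma E_ofComplex_I_mul_eq {k : ℕ} (hk : 3 ≤ k) (hk2 : Even k) {t : ℝ} (ht : 0 < t) :
    E hk (ofComplex (Complex.I * t)) = ((1 - 2 * k / bernoulli k *
      ∑' n : ℕ+, σ (k - 1) n * Real.exp (-2 * Real.pi * t) ^ (n : ℕ) : ℝ) : ℂ) := by
  have hq : Complex.exp (2 * Real.pi * Complex.I * (Complex.I * t)) =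
      (Real.exp (-2 * Real.pi * t) : ℝ) := by
    push_cast
    congr 1
    linear_combination 2 * Real.pi * t * Complex.I_mul_I
  rw [q_expansion_bernoulli hk hk2, coe_ofComplex_I_mul ht, hq]
  push_cast
  simp only [zpow_natCast]

lemma E_ofComplex_I_mul {k : ℕ} (hk : 3 ≤ k) (hk2 : Even k) {t : ℝ} (ht : 0 < t) :
    E hk (ofComplex (Complex.I * t)) = (imagAxis hk t : ℂ) := by
  rw [imagAxis, E_ofComplex_I_mul_eq hk hk2 ht, Complex.ofReal_re]

/-- As `B₄ = -1/30`, the series is `1 + 240 ∑ σ₃(n) qⁿ` with `q > 0`. -/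
lemma imagAxis_four_pos {t : ℝ} (ht : 0 < t) : 0 < imagAxis (by norm_num : 3 ≤ 4) t := by
  rw [imagAxis, E_ofComplex_I_mul_eq _ (by decide) ht, Complex.ofReal_re,
    show bernoulli 4 = -1 / 30 by decide +kernel]
  have : 0 ≤ ∑' n : ℕ+, (σ (4 - 1) n : ℝ) * Real.exp (-2 * Real.pi * t) ^ (n : ℕ) :=
    tsum_nonneg fun n ↦ by positivity
  push_cast
  linarith

lemma continuousOn_imagAxis {k : ℕ} (hk : 3 ≤ k) : ContinuousOn (imagAxis hk) (Set.Ioi 0) := by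
  have h := (UpperHalfPlane.mdifferentiable_iff.mp (ModularFormClass.holo (E hk))).continuousOn
  refine Complex.continuous_re.comp_continuousOn
    (h.comp (f := fun t : ℝ ↦ Complex.I * t) (by fun_prop) fun t ht ↦ ?_)
  simpa using! ht

lemma tendsto_imagAxis {k : ℕ} (hk : 3 ≤ k) (hk2 : Even k) :
    Tendsto (imagAxis hk) atTop (𝓝 1) := by
  have han := ModularFormClass.analyticAt_cuspFunction_zero (E hk) one_pos one_mem_strictPeriods_SL
  have h0 : cuspFunction 1 (E hk) 0 = 1 := by
    have := E_qExpansion_coeff_zero hk hk2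
    rw [qExpansion_coeff] at this
    simpa using this
  have hat : Tendsto (fun t : ℝ ↦ ofComplex (Complex.I * t)) atTop atImInfty := by
    rw [atImInfty, tendsto_comap_iff]
    refine tendsto_id.congr' ?_
    filter_upwards [eventually_gt_atTop 0] with t ht
    simp [ofComplex_apply_of_im_pos, ht, ← coe_im]
  have h := han.continuousAt.tendsto.comp ((qParam_tendsto_atImInfty one_pos).comp hat)
  rw [h0] at h
  refine ((Complex.continuous_re.tendsto _).comp h).congr fun t ↦ ?_
  simp only [Function.comp_apply, imagAxis]
  rw [SlashInvariantFormClass.eq_cuspFunction (E hk) _ one_mem_strictPeriods_SL one_ne_zero]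

/-- This is modularity under `τ ↦ -1/τ`, which sends `it` to `i/t`. -/
lemma E_ofComplex_I_mul_inv {k : ℕ} (hk : 3 ≤ k) {t : ℝ} (ht : 0 < t) :
    E hk (ofComplex (Complex.I * (t⁻¹ : ℝ))) =
      (Complex.I * t) ^ k * E hk (ofComplex (Complex.I * t)) := by
  set z : ℍ := ofComplex (Complex.I * t) with hz
  have hzc : (z : ℂ) = Complex.I * t := coe_ofComplex_I_mul ht
  have hS := SlashInvariantForm.slash_S_apply (E hk) k z
  have hinv : (E hk : ℍ → ℂ) ∣[(k : ℤ)] ModularGroup.S = E hk := by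
    exact SlashInvariantForm.slash_action_eqn (E hk) _ (by simp)
  rw [hinv] at hS
  have hpt : UpperHalfPlane.mk _ z.im_inv_neg_coe_pos = ofComplex (Complex.I * (t⁻¹ : ℝ)) := by
    ext
    rw [coe_ofComplex_I_mul (inv_pos.mpr ht)]
    simp only [hzc]
    have : (t : ℂ) ≠ 0 := by exact_mod_cast ht.ne'
    push_cast
    simp [mul_comm]
  rw [hpt, hzc] at hS
  have h0 : Complex.I * (t : ℂ) ≠ 0 := by simp [ht.ne']
  rw [hS, zpow_neg, zpow_natCast]
  field_simp

end EisensteinSeries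

namespace EisensteinSeries

/-- The function `E₆ / E₄ ^ (3 / 2)` takes every value in `(-1, 1)` on the positive imaginary
axis. -/
lemma exists_imagAxis_six_div_eq {y : ℝ} (hy : y ∈ Set.Ioo (-1 : ℝ) 1) :
    ∃ t : ℝ, 0 < t ∧ imagAxis (by norm_num : 3 ≤ 6) t /
      √(imagAxis (by norm_num : 3 ≤ 4) t) ^ 3 = y := by
  set e : ℝ → ℝ := imagAxis (by norm_num : 3 ≤ 4)
  set f : ℝ → ℝ := imagAxis (by norm_num : 3 ≤ 6)
  have hpos : ∀ t, 0 < t → 0 < √(e t) := fun t ht ↦ Real.sqrt_pos.mpr (imagAxis_four_pos ht)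
  have hcont : ContinuousOn (fun t ↦ f t / √(e t) ^ 3) (Set.Ioi 0) :=
    (continuousOn_imagAxis _).div (((continuousOn_imagAxis _).sqrt).pow 3)
      fun t ht ↦ (pow_pos (hpos t ht) 3).ne'
  have htop : Tendsto (fun t ↦ f t / √(e t) ^ 3) atTop (𝓝 1) := by
    have h4 : Tendsto e atTop (𝓝 1) := tendsto_imagAxis _ (by decide)
    have h6 : Tendsto f atTop (𝓝 1) := tendsto_imagAxis _ (by decide)
    simpa using! h6.div (h4.sqrt.pow 3) (by simp)
  -- The sign comes from `i⁶ = -1` against `i⁴ = 1`; it turns the limit `1` at infinity into `-1` at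
  -- `0`.
  have hinv : ∀ t, 0 < t → f t⁻¹ / √(e t⁻¹) ^ 3 = -(f t / √(e t) ^ 3) := by
    intro t ht
    have h4 : e t⁻¹ = (t ^ 2) ^ 2 * e t := by
      have := E_ofComplex_I_mul_inv (by norm_num : 3 ≤ 4) ht
      rw [E_ofComplex_I_mul _ (by decide) (inv_pos.mpr ht), E_ofComplex_I_mul _ (by decide) ht,
        mul_pow, Complex.I_pow_four, one_mul] at this
      rw [← pow_mul]
      exact_mod_cast this
    have h6 : f t⁻¹ = -t ^ 6 * f t := by
      have := E_ofComplex_I_mul_inv (by norm_num : 3 ≤ 6) ht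
      rw [E_ofComplex_I_mul _ (by decide) (inv_pos.mpr ht), E_ofComplex_I_mul _ (by decide) ht,
        mul_pow, show Complex.I ^ 6 = -1 by rw [pow_mul Complex.I 2 3, Complex.I_sq]; norm_num,
        neg_one_mul] at this
      exact_mod_cast this
    rw [h4, h6, Real.sqrt_mul (by positivity), Real.sqrt_sq (by positivity)]
    have := (hpos t ht).ne'
    field_simp
  have hzero : Tendsto (fun t ↦ f t / √(e t) ^ 3) (𝓝[>] 0) (𝓝 (-1)) := by
    refine ((htop.comp tendsto_inv_nhdsGT_zero).neg).congr' ?_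
    filter_upwards [self_mem_nhdsWithin] with t ht
    simp only [Function.comp_apply]
    rw [hinv t ht, neg_neg]
  obtain ⟨t, ht, h⟩ := isPreconnected_Ioi.intermediate_value_Ioo (l₁ := 𝓝[>] (0 : ℝ))
    inf_le_right (le_principal_iff.mpr (Ioi_mem_atTop 0)) hcont hzero htop hy
  exact ⟨t, ht, h⟩

end EisensteinSeries

namespace PeriodPair

open EisensteinSeries in
/-- Real invariants with positive discriminant are the invariants of a lattice. -/
theorem exists_invariants_eq {a b : ℝ} (ha : 0 < a) (hab : 27 * b ^ 2 < a ^ 3) :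
    ∃ L : PeriodPair, L.g₂ = a ∧ L.g₃ = b := by
  have hr : 0 < √a := Real.sqrt_pos.mpr ha
  have hra : √a ^ 2 = a := Real.sq_sqrt ha.le
  have h3 : 0 < √(3 : ℝ) := by positivity
  have h33 : √(3 : ℝ) ^ 2 = 3 := Real.sq_sqrt (by norm_num)
  have hy : |3 * √3 * b / √a ^ 3| < 1 := by
    rw [← sq_lt_one_iff_abs_lt_one, div_pow, div_lt_one (by positivity)]
    calc (3 * √3 * b) ^ 2 = 27 * b ^ 2 := by rw [mul_pow, mul_pow, h33]; ring
      _ < a ^ 3 := hab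
      _ = (√a ^ 3) ^ 2 := by rw [← pow_mul, mul_comm 3 2, pow_mul, hra]
  obtain ⟨t, ht, hty⟩ := exists_imagAxis_six_div_eq (abs_lt.mp hy)
  have he := imagAxis_four_pos ht
  have h4 := E_ofComplex_I_mul (by norm_num : 3 ≤ 4) (by decide) ht
  have h6 := E_ofComplex_I_mul (by norm_num : 3 ≤ 6) (by decide) ht
  set e := imagAxis (by norm_num : 3 ≤ 4) t
  set f := imagAxis (by norm_num : 3 ≤ 6) t
  have hs : 0 < √e := Real.sqrt_pos.mpr he
  have hse : √e ^ 2 = e := Real.sq_sqrt he.le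
  have hd : 0 < 2 * Real.pi ^ 2 * √e / (√3 * √a) := by positivity
  -- This `c` solves `c⁴ = 4π⁴e/(3a)`, making the scaled `g₂` equal to `a`; the choice of `t` then
  -- gives `g₃ = b`.
  set c : ℝ := √(2 * Real.pi ^ 2 * √e / (√3 * √a))
  have hc0 : 0 < c := Real.sqrt_pos.mpr hd
  have hc : c ^ 2 = 2 * Real.pi ^ 2 * √e / (√3 * √a) := Real.sq_sqrt hd.le
  refine ⟨(ofUpperHalfPlane (UpperHalfPlane.ofComplex (Complex.I * t))).scale c
    (by exact_mod_cast hc0.ne'), ?_, ?_⟩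
  · rw [g₂_scale, g₂_ofUpperHalfPlane, h4]
    have : (c ^ 4)⁻¹ * (4 * Real.pi ^ 4 / 3 * e) = a := by
      rw [show c ^ 4 = (c ^ 2) ^ 2 by ring, hc, div_pow, mul_pow, mul_pow, mul_pow, hse, h33, hra]
      field_simp
      norm_num
    exact_mod_cast this
  · rw [g₃_scale, g₃_ofUpperHalfPlane, h6]
    have hf : f = 3 * √3 * b / √a ^ 3 * √e ^ 3 := by
      rw [← hty]
      field_simp
    have : (c ^ 6)⁻¹ * (8 * Real.pi ^ 6 / 27 * f) = b := by
      rw [show c ^ 6 = (c ^ 2) ^ 3 by ring, hc, hf]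
      field_simp
      rw [show √(3 : ℝ) ^ 4 = (√3 ^ 2) ^ 2 by ring, h33]
      norm_num
    exact_mod_cast this

end PeriodPair

/-! ### The two families of Weierstrass functions -/

/-- At most one function has given invariants. -/
lemma IsWeierstrassP.unique {g₂ g₃ : ℂ} {f h : ℂ → ℂ} (hf : IsWeierstrassP g₂ g₃ f)
    (hh : IsWeierstrassP g₂ g₃ h) : f = h := by
  obtain ⟨L, hL₂, hL₃, rfl⟩ := hf
  obtain ⟨M, hM₂, hM₃, rfl⟩ := hh
  exact PeriodPair.weierstrassP_eq_of_invariants (hL₂.trans hM₂.symm) (hL₃.trans hM₃.symm)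

/-- Homogeneity of the Weierstrass function in its invariants. -/
lemma IsWeierstrassP.comp_mul {g₂ g₃ : ℂ} {f : ℂ → ℂ} (hf : IsWeierstrassP g₂ g₃ f) {c : ℂ}
    (hc : c ≠ 0) : IsWeierstrassP (c ^ 4 * g₂) (c ^ 6 * g₃) (fun z ↦ c ^ 2 * f (c * z)) := by
  obtain ⟨L, rfl, rfl, rfl⟩ := hf
  refine ⟨L.scale c⁻¹ (inv_ne_zero hc), ?_, ?_, ?_⟩
  · rw [L.g₂_scale]
    simp
  · rw [L.g₃_scale]
    simp
  · funext z
    have := L.weierstrassP_scale c⁻¹ (inv_ne_zero hc) (c * z)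
    rw [inv_mul_cancel_left₀ hc] at this
    rw [this]
    simp

lemma isWeierstrassP_existsUnique_of_real {a b : ℝ} (ha : 0 < a) (hab : 27 * b ^ 2 < a ^ 3) :
    ∃! f : ℂ → ℂ, IsWeierstrassP a b f := by
  obtain ⟨L, h₂, h₃⟩ := PeriodPair.exists_invariants_eq ha hab
  exact ⟨L.weierstrassP, ⟨L, h₂, h₃, rfl⟩, fun f hf ↦ hf.unique ⟨L, h₂, h₃, rfl⟩⟩

/-- The factor `(3 √2 i) ^ 2 = -18` relates the two families of Weierstrass functions. -/
lemma IsShenSmallP.isShenP {κ : ℝ} {p : ℂ → ℂ} (hp : IsShenSmallP κ p) :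
    IsShenP κ (fun z ↦ -18 * p (3 * ((Real.sqrt 2 : ℝ) : ℂ) * Complex.I * z)) := by
  have h2 : ((Real.sqrt 2 : ℝ) : ℂ) ^ 2 = 2 := by
    rw [← Complex.ofReal_pow, Real.sq_sqrt (by norm_num)]
    norm_num
  have hsq : (3 * ((Real.sqrt 2 : ℝ) : ℂ) * Complex.I) ^ 2 = -18 := by
    rw [mul_pow, mul_pow, h2, Complex.I_sq]
    norm_num
  have hc : 3 * ((Real.sqrt 2 : ℝ) : ℂ) * Complex.I ≠ 0 := by
    intro h
    norm_num [h] at hsq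
  have h := IsWeierstrassP.comp_mul hp hc
  rw [show 4 = 2 * 2 by rfl, show 6 = 2 * 3 by rfl, pow_mul, pow_mul _ 2 3, hsq] at h
  unfold IsShenP
  convert! h using 1 <;> ring

theorem mainTheorem1 (κ : ℝ) (hκ0 : 0 < κ) (hκ1 : κ < 1) :
    (∃! P : ℂ → ℂ, IsShenP κ P) ∧ (∃! p : ℂ → ℂ, IsShenSmallP κ p) ∧
      ∀ P p : ℂ → ℂ, IsShenP κ P → IsShenSmallP κ p →
        ∀ z : ℂ, P z = -18 * p (3 * ((Real.sqrt 2 : ℝ) : ℂ) * Complex.I * z) := by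
  -- For the invariants of `p`, `g₂³ - 27g₃²` is `4096/19683` times this quantity.
  have hpos : 0 < κ ^ 2 * (1 - κ ^ 2) ^ 3 :=
    mul_pos (by positivity) (pow_pos (by nlinarith) 3)
  have hsmall : ∃! p : ℂ → ℂ, IsShenSmallP κ p := by
    have := isWeierstrassP_existsUnique_of_real (a := 4 / 27 * (8 * κ ^ 2 + 1))
      (b := 8 / 729 * (8 * κ ^ 4 + 20 * κ ^ 2 - 1)) (by positivity) (by linarith)
    push_cast at this
    exact this
  obtain ⟨p₀, hp₀, -⟩ := hsmall
  refine ⟨⟨_, hp₀.isShenP, fun P hP ↦ IsWeierstrassP.unique hP hp₀.isShenP⟩,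
    ⟨p₀, hp₀, fun p hp ↦ IsWeierstrassP.unique hp hp₀⟩, fun P p hP hp z ↦ ?_⟩
  exact congrFun (IsWeierstrassP.unique hP hp.isShenP) z
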